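/- Let $f:\mathbb{R}^d\to\mathbb{R}$ be twice differentiable and bounded below by $\bar f$, with $L$-Lipschitz gradient and $M$-Lipschitz Hessian (Euclidean and spectral norm), $L,M>0$. Let $\epsilon_g,\epsilon_H>0$, $\alpha\ge\epsilon_H$, $x_0\in\mathbb{R}^d$, and consider the following algorithm. In iteration $k=0,1,2,\dots$ it obtains an inexact gradient $g_k$ at $x_k$. * If $\|g_k\|>\epsilon_g$, it sets $x_{k+1}=x_k-\frac1L g_k$. * Otherwise it obtains a symmetric inexact Hessian $H_k$ and a unit vector $\hat p_k$, and sets $\hat\lambda_k=\hat p_k^TH_k\hat p_k$. If $\hat\lambda_k<-\epsilon_H$, it chooses $\alpha_k\in[\epsilon_H,\min(\alpha,|\hat\lambda_k|)]$, draws a sign $\sigma_k=\pm1$ with probability $\frac12$ each, and sets $x_{k+1}=x_k+\frac{2\alpha_k}{M}\sigma_k\hat p_k$. * Otherwise it returns $x_k$ and stops. Here $g_k,H_k,\hat p_k,\alpha_k$ may depend in any (measurable) way on the past, possibly with randomness of their own, and $\sigma_k$ is independent of everything that precedes it (including $g_k,H_k,\hat p_k,\alpha_k$). Assume that almost surely,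 in every executed iteration $k$, $$\|g_k-\nabla f(x_k)\|\le\tfrac13\max\{\epsilon_g,\|g_k\|\},$$ and, if $\|g_k\|\le\epsilon_g$, also $$\|H_k-\nabla^2f(x_k)\|\le\tfrac29\epsilon_H,\qquad |\hat\lambda_k-\lambda_{\min}(H_k)|\le\tfrac19\epsilon_H.$$ Let $\delta\in(0,1)$, let $\eta\ge2$ be an integer, and put $$C_\epsilon=\min\left(\frac{\epsilon_g^2}{6L},\frac{2\epsilon_H^3}{9M^2}\right),\qquad B=1+\frac{18\alpha L}{M\epsilon_g},\qquad C=2304\,\frac{M^2\alpha^2\epsilon_g^2}{\epsilon_H^6},$$ $$K=\max\left\{C\log\frac1\delta,\ 4\eta C\left(\frac{f(x_0)-\bar f}{C_\epsilon}\right)^{1/\eta},\ 4\eta^2C^{1+\frac1{\eta-1}}B^{\frac1{\eta-1}}\right\},\qquad n=2\,\frac{f(x_0)-\bar f}{C_\epsilon}+BK.$$ Then with probability at least $1-\delta$ the algorithm returns in some iteration $k<n$ (so it executes at most $\lceil n\rceil$ iterations, the returning one included). -/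

import Mathlib

open MeasureTheory ProbabilityTheory

noncomputable section

namespace RandNC

/-- The space `ℝ^d` with the Euclidean norm. -/
abbrev Vec (d : ℕ) := EuclideanSpace ℝ (Fin d)

/-- The Hessian `∇²f(x)`, as a linear operator on `ℝ^d` (so `‖·‖` is the spectral norm). -/
def hessian {d : ℕ} (f : Vec d → ℝ) (x : Vec d) : Vec d →L[ℝ] Vec d :=
  fderiv ℝ (gradient f) x

/-- The smallest (real) eigenvalue of an operator on `ℝ^d`; used for symmetric operators. -/
def lambdaMin {d : ℕ} (H : Vec d →L[ℝ] Vec d) : ℝ :=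
  sInf {c : ℝ | Module.End.HasEigenvalue (H : Vec d →ₗ[ℝ] Vec d) c}

/-- `f` is twice differentiable with `L`-Lipschitz gradient and `M`-Lipschitz Hessian,
and is bounded below by `fbar`. -/
structure Smooth {d : ℕ} (f : Vec d → ℝ) (L M fbar : ℝ) : Prop where
  differentiable : Differentiable ℝ f
  differentiable_gradient : Differentiable ℝ (gradient f)
  gradient_lipschitz : ∀ x y, ‖gradient f x - gradient f y‖ ≤ L * ‖x - y‖
  hessian_lipschitz : ∀ x y, ‖hessian f x - hessian f y‖ ≤ M * ‖x - y‖
  lower_bound : ∀ x, fbar ≤ f x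

/-- Input parameters of the algorithm: the Lipschitz constants `L`, `M`, the tolerances
`εg`, `εH`, and the upper bound `α` on the negative curvature step sizes. -/
structure Params where
  L : ℝ
  M : ℝ
  εg : ℝ
  εH : ℝ
  α : ℝ
  L_pos : 0 < L
  M_pos : 0 < M
  εg_pos : 0 < εg
  εH_pos : 0 < εH
  εH_le_α : εH ≤ α

/-- What the algorithm receives, chooses and draws in iteration `k` (as a function of the
outcome `ω`): the inexact gradient `g k`, the inexact Hessian `H k`, the approximate
minimum eigenvector `p k`, the chosen step size `a k`, and the random sign `σ k`. -/
structure Inputs (d : ℕ) (Ω : Type*) where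
  g : ℕ → Ω → Vec d
  H : ℕ → Ω → (Vec d →L[ℝ] Vec d)
  p : ℕ → Ω → Vec d
  a : ℕ → Ω → ℝ
  σ : ℕ → Ω → ℝ

variable {d : ℕ} {Ω : Type*}

/-- The approximate minimum eigenvalue `p̂ₖᵀ Hₖ p̂ₖ`. -/
def lamHat (S : Inputs d Ω) (k : ℕ) (ω : Ω) : ℝ :=
  inner ℝ (S.p k ω) (S.H k ω (S.p k ω))

/-- First branch of the loop: a gradient step is taken. -/
def GradStep (P : Params) (S : Inputs d Ω) (k : ℕ) (ω : Ω) : Prop :=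
  P.εg < ‖S.g k ω‖

/-- Second branch of the loop: a negative curvature step is taken. -/
def NCStep (P : Params) (S : Inputs d Ω) (k : ℕ) (ω : Ω) : Prop :=
  ¬ GradStep P S k ω ∧ lamHat S k ω < -P.εH

/-- Third branch of the loop: the algorithm returns the current iterate. -/
def StopTest (P : Params) (S : Inputs d Ω) (k : ℕ) (ω : Ω) : Prop :=
  ¬ GradStep P S k ω ∧ ¬ lamHat S k ω < -P.εH

open Classical in
/-- The iterates `xₖ` of the algorithm started at `x₀`. They are meaningful up to the
iteration at which the algorithm returns; the later values play no role. -/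
def iterate (P : Params) (S : Inputs d Ω) (x₀ : Vec d) : ℕ → Ω → Vec d
  | 0, _ => x₀
  | k + 1, ω =>
    if GradStep P S k ω then
      iterate P S x₀ k ω - (1 / P.L) • S.g k ω
    else if lamHat S k ω < -P.εH then
      iterate P S x₀ k ω + (2 * S.a k ω / P.M * S.σ k ω) • S.p k ω
    else
      iterate P S x₀ k ω

/-- Iteration `k` is executed: the algorithm has not returned in an earlier iteration. -/
def Reached (P : Params) (S : Inputs d Ω) (k : ℕ) (ω : Ω) : Prop :=
  ∀ j < k, ¬ StopTest P S j ω

/-- The algorithm returns `xₖ`, in iteration `k`. -/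
def ReturnsAt (P : Params) (S : Inputs d Ω) (k : ℕ) (ω : Ω) : Prop :=
  Reached P S k ω ∧ StopTest P S k ω

/-- The information structure of the algorithm. `ℱ k` is the information available just
before the sign `σ k` is drawn: `g k`, `H k`, `p k`, `a k` may depend on it in any way, and
`σ k` is a fresh fair sign, independent of it. -/
structure FairSigns [mΩ : MeasurableSpace Ω] (μ : Measure Ω) (ℱ : Filtration ℕ mΩ)
    (S : Inputs d Ω) : Prop where
  g_meas : ∀ k, StronglyMeasurable[ℱ k] (S.g k)
  H_meas : ∀ k, StronglyMeasurable[ℱ k] (S.H k)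
  p_meas : ∀ k, StronglyMeasurable[ℱ k] (S.p k)
  a_meas : ∀ k, StronglyMeasurable[ℱ k] (S.a k)
  σ_meas : ∀ k, StronglyMeasurable[ℱ (k + 1)] (S.σ k)
  σ_pos : ∀ k, μ {ω | S.σ k ω = 1} = 1 / 2
  σ_neg : ∀ k, μ {ω | S.σ k ω = -1} = 1 / 2
  σ_indep : ∀ k, Indep (MeasurableSpace.comap (S.σ k) inferInstance) (ℱ k) μ

/-- Inexactness of the gradients, and of the Hessians (symmetric; requested when no
gradient step is taken), in every executed iteration. -/
def InexactDerivatives [MeasurableSpace Ω] (μ : Measure Ω) (f : Vec d → ℝ) (P : Params)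
    (S : Inputs d Ω) (x₀ : Vec d) : Prop :=
  ∀ᵐ ω ∂μ, ∀ k, Reached P S k ω →
    ‖S.g k ω - gradient f (iterate P S x₀ k ω)‖ ≤ 1 / 3 * max P.εg ‖S.g k ω‖ ∧
    (¬ GradStep P S k ω →
      (S.H k ω : Vec d →ₗ[ℝ] Vec d).IsSymmetric ∧
      ‖S.H k ω - hessian f (iterate P S x₀ k ω)‖ ≤ 2 / 9 * P.εH)

/-- `p k` is a unit vector whose Rayleigh quotient is within `εH / 9` of the minimum
eigenvalue of `H k`, in every executed iteration that requests it. -/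
def ApproxEigenvector [MeasurableSpace Ω] (μ : Measure Ω) (P : Params)
    (S : Inputs d Ω) : Prop :=
  ∀ᵐ ω ∂μ, ∀ k, Reached P S k ω → ¬ GradStep P S k ω →
    ‖S.p k ω‖ = 1 ∧ |lamHat S k ω - lambdaMin (S.H k ω)| ≤ 1 / 9 * P.εH

/-- The step size rule `αₖ ∈ [εH, min(α, |λ̂ₖ|)]` at negative curvature steps. -/
def StepSizeRule [MeasurableSpace Ω] (μ : Measure Ω) (P : Params) (S : Inputs d Ω) : Prop :=
  ∀ᵐ ω ∂μ, ∀ k, Reached P S k ω → NCStep P S k ω →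
    S.a k ω ∈ Set.Icc P.εH (min P.α |lamHat S k ω|)

def Ceps (P : Params) : ℝ :=
  min (P.εg ^ 2 / (6 * P.L)) (2 * P.εH ^ 3 / (9 * P.M ^ 2))

def constB (P : Params) : ℝ := 1 + 18 * P.α * P.L / (P.M * P.εg)

def constC (P : Params) : ℝ := 2304 * (P.M ^ 2 * P.α ^ 2 * P.εg ^ 2 / P.εH ^ 6)

/-- The constant `K`, where `Δ` stands for `f(x₀) - fbar`. -/
def constK (P : Params) (Δ δ : ℝ) (η : ℕ) : ℝ :=
  max (constC P * Real.log (1 / δ))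
    (max (4 * η * constC P * (Δ / Ceps P) ^ (1 / (η : ℝ)))
      (4 * (η : ℝ) ^ 2 * constC P ^ (1 + 1 / ((η : ℝ) - 1)) *
        constB P ^ (1 / ((η : ℝ) - 1))))

/-- The iteration bound `n`, where `Δ` stands for `f(x₀) - fbar`. -/
def iterBound (P : Params) (Δ δ : ℝ) (η : ℕ) : ℝ :=
  2 * (Δ / Ceps P) + constB P * constK P Δ δ η

end RandNC

end

namespace RandNC

/-! ### Taylor bounds -/

/-! Suppose the algorithm has not returned before `m = ⌈n⌉`, and let `N` of the first `m` steps be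
negative curvature steps. Put `cg = εg²/(6L)`, `c₁ = 2εH³/(9M²)` and `c = 8αεg/(3M)`. A gradient
step lowers `f` by at least `cg`. A negative curvature step lowers it by at least `c₁`, up to a
first-order term: a fair sign times a coefficient known before the sign is drawn and bounded by `c`.
Telescoping gives `cg (m - N) + c₁ N ≤ Δ + T`, where `T` is the sum of these signed terms and `Δ =
f(x₀) - fbar`.

Since `T ≤ c N`, few negative curvature steps would mean too many gradient steps for the available
decrease; this forces `N ≥ K`. Since `m ≥ 2Δ/Cε`, at most half of the guaranteed decrease is paid
for by `Δ`, so `T ≥ c₁ N / 2`, while the squared coefficients add up to at most `c² N`. Such a `T`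
is improbable: for predictable `uₖ`, `exp ∑ (σₖ uₖ - uₖ²/2)` is a supermartingale, and Markov's
inequality applies (`measure_le_of_fair_signs`). With `uₖ` a fixed multiple of the coefficients the
exponent is at least linear in `N`, so no union bound over the random `N` is needed. The
deterministic part of the argument is `log_le_of_iterBound_le`. -/

lemma antitoneOn_Ici_of_hasDerivAt_nonpos {φ φ' : ℝ → ℝ} (h : ∀ t, HasDerivAt φ (φ' t) t)
    (hφ' : ∀ t, 0 ≤ t → φ' t ≤ 0) : AntitoneOn φ (Set.Ici 0) := by
  have hd : Differentiable ℝ φ := fun t => (h t).differentiableAt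
  refine antitoneOn_of_deriv_nonpos (convex_Ici 0) hd.continuous.continuousOn
    hd.differentiableOn fun t ht => ?_
  rw [interior_Ici] at ht
  rw [(h t).deriv]
  exact hφ' t (Set.mem_Ioi.1 ht).le

section Taylor

variable {d : ℕ} {f : Vec d → ℝ} {L M fbar : ℝ}

lemma Smooth.hasDerivAt_line (hf : Smooth f L M fbar) (x v : Vec d) (t : ℝ) :
    HasDerivAt (fun s : ℝ => f (x + s • v)) (inner ℝ (gradient f (x + t • v)) v) t := by
  have hl : HasDerivAt (fun s : ℝ => x + s • v) v t := by
    simpa using ((hasDerivAt_id t).smul_const v).const_add x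
  have h := (hf.differentiable (x + t • v)).hasGradientAt.hasFDerivAt.comp_hasDerivAt t hl
  refine h.congr_deriv ?_
  rw [InnerProductSpace.toDual_apply_apply]

lemma Smooth.hasDerivAt_inner_gradient_line (hf : Smooth f L M fbar) (x v : Vec d) (t : ℝ) :
    HasDerivAt (fun s : ℝ => inner ℝ (gradient f (x + s • v)) v)
      (inner ℝ (hessian f (x + t • v) v) v) t := by
  have hl : HasDerivAt (fun s : ℝ => x + s • v) v t := by
    simpa using ((hasDerivAt_id t).smul_const v).const_add x
  have h := (hf.differentiable_gradient (x + t • v)).hasFDerivAt.comp_hasDerivAt t hl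
  simpa [hessian] using h.inner ℝ (hasDerivAt_const t v)

/-- Along the segment, `f` minus its quadratic upper model has nonpositive derivative. Monotonicity
replaces the integral remainder, so the derivatives need not be integrated. -/
lemma Smooth.le_add_of_gradient_lipschitz (hf : Smooth f L M fbar) (x v : Vec d) :
    f (x + v) ≤ f x + inner ℝ (gradient f x) v + L / 2 * ‖v‖ ^ 2 := by
  have hd : ∀ t : ℝ, HasDerivAt
      (fun s : ℝ => f (x + s • v) - s * inner ℝ (gradient f x) v - L / 2 * ‖v‖ ^ 2 * s ^ 2)
      (inner ℝ (gradient f (x + t • v)) v - inner ℝ (gradient f x) v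
        - L * ‖v‖ ^ 2 * t) t := fun t => by
    have := ((hf.hasDerivAt_line x v t).sub
      ((hasDerivAt_id t).mul_const (inner ℝ (gradient f x) v))).sub
      ((hasDerivAt_pow 2 t).const_mul (L / 2 * ‖v‖ ^ 2))
    refine this.congr_deriv ?_
    simp
    ring
  have h := antitoneOn_Ici_of_hasDerivAt_nonpos hd (fun t ht => by
    rw [← inner_sub_left]
    have h1 := real_inner_le_norm (gradient f (x + t • v) - gradient f x) v
    have h2 := hf.gradient_lipschitz (x + t • v) x
    rw [add_sub_cancel_left, norm_smul, Real.norm_of_nonneg ht] at h2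
    have h3 := mul_le_mul_of_nonneg_right h2 (norm_nonneg v)
    linarith [show L * (t * ‖v‖) * ‖v‖ = L * ‖v‖ ^ 2 * t by ring])
    Set.self_mem_Ici (Set.mem_Ici.2 zero_le_one) zero_le_one
  simp [-inner_gradient_left] at h
  linarith

/-- The same monotonicity argument, used twice: first for the directional derivative, then for `f`
itself. -/
lemma Smooth.le_add_of_hessian_lipschitz (hf : Smooth f L M fbar) (x v : Vec d) :
    f (x + v) ≤ f x + inner ℝ (gradient f x) v + 1 / 2 * inner ℝ (hessian f x v) v
      + M / 6 * ‖v‖ ^ 3 := by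
  have hd₂ : ∀ t : ℝ, HasDerivAt
      (fun s : ℝ => inner ℝ (gradient f (x + s • v)) v - s * inner ℝ (hessian f x v) v
        - M / 2 * ‖v‖ ^ 3 * s ^ 2)
      (inner ℝ (hessian f (x + t • v) v) v - inner ℝ (hessian f x v) v
        - M * ‖v‖ ^ 3 * t) t := fun t => by
    have := ((hf.hasDerivAt_inner_gradient_line x v t).sub
      ((hasDerivAt_id t).mul_const (inner ℝ (hessian f x v) v))).sub
      ((hasDerivAt_pow 2 t).const_mul (M / 2 * ‖v‖ ^ 3))
    refine this.congr_deriv ?_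
    simp
    ring
  have h₂ := antitoneOn_Ici_of_hasDerivAt_nonpos hd₂ (fun t ht => by
    rw [← inner_sub_left, ← sub_apply]
    have h1 := real_inner_le_norm ((hessian f (x + t • v) - hessian f x) v) v
    have h2 := hf.hessian_lipschitz (x + t • v) x
    rw [add_sub_cancel_left, norm_smul, Real.norm_of_nonneg ht] at h2
    have h3 := mul_le_mul_of_nonneg_right
      ((hessian f (x + t • v) - hessian f x).le_of_opNorm_le h2 v) (norm_nonneg v)
    linarith [show M * (t * ‖v‖) * ‖v‖ * ‖v‖ = M * ‖v‖ ^ 3 * t by ring])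
  have hd₁ : ∀ t : ℝ, HasDerivAt
      (fun s : ℝ => f (x + s • v) - s * inner ℝ (gradient f x) v
        - 1 / 2 * inner ℝ (hessian f x v) v * s ^ 2 - M / 6 * ‖v‖ ^ 3 * s ^ 3)
      (inner ℝ (gradient f (x + t • v)) v - inner ℝ (gradient f x) v
        - t * inner ℝ (hessian f x v) v - M / 2 * ‖v‖ ^ 3 * t ^ 2) t := fun t => by
    have := (((hf.hasDerivAt_line x v t).sub
      ((hasDerivAt_id t).mul_const (inner ℝ (gradient f x) v))).sub
      ((hasDerivAt_pow 2 t).const_mul (1 / 2 * inner ℝ (hessian f x v) v))).sub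
      ((hasDerivAt_pow 3 t).const_mul (M / 6 * ‖v‖ ^ 3))
    refine this.congr_deriv ?_
    simp
    ring
  have h := antitoneOn_Ici_of_hasDerivAt_nonpos hd₁ (fun t ht => by
    have := h₂ Set.self_mem_Ici (Set.mem_Ici.2 ht) ht
    simp [-inner_gradient_left] at this
    linarith) Set.self_mem_Ici (Set.mem_Ici.2 zero_le_one) zero_le_one
  simp [-inner_gradient_left] at h
  linarith

end Taylor

/-! ### An exponential supermartingale for fair signs -/

lemma half_exp_add_half_exp_le_one (u : ℝ) :
    1 / 2 * Real.exp (u - u ^ 2 / 2) + 1 / 2 * Real.exp (-u - u ^ 2 / 2) ≤ 1 := by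
  have h : 1 / 2 * Real.exp (u - u ^ 2 / 2) + 1 / 2 * Real.exp (-u - u ^ 2 / 2)
      = Real.cosh u / Real.exp (u ^ 2 / 2) := by
    rw [Real.cosh_eq, Real.exp_sub, Real.exp_sub]
    ring
  rw [h, div_le_one (Real.exp_pos _)]
  exact Real.cosh_le_exp_half_sq u

section Signs

variable {Ω : Type*} [mΩ : MeasurableSpace Ω] {μ : Measure Ω} [IsProbabilityMeasure μ]

lemma ae_eq_one_or_eq_neg_one {σ : Ω → ℝ} (hσ : Measurable σ)
    (hpos : μ {ω | σ ω = 1} = 1 / 2) (hneg : μ {ω | σ ω = -1} = 1 / 2) :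
    ∀ᵐ ω ∂μ, σ ω = 1 ∨ σ ω = -1 := by
  have hm : ∀ c : ℝ, MeasurableSet {ω | σ ω = c} := fun c => hσ (measurableSet_singleton c)
  have hd : Disjoint {ω | σ ω = 1} {ω | σ ω = -1} := by
    rw [Set.disjoint_left]
    intro ω h1 h2
    simp only [Set.mem_ofPred_eq] at h1 h2
    linarith
  have h : μ ({ω | σ ω = 1} ∪ {ω | σ ω = -1}) = 1 := by
    rw [measure_union hd (hm _), hpos, hneg, ENNReal.add_halves]
  exact (mem_ae_iff_prob_eq_one ((hm _).union (hm _))).2 h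

/-- Splitting over `σ = 1` and `σ = -1`, independence turns each indicator into a factor `1/2`, and
the average of the two exponentials is at most 1 because `cosh u ≤ exp (u²/2)`. Working with
`lintegral` avoids any integrability or boundedness condition on `u`. -/
lemma lintegral_mul_exp_sign_le {Ω : Type*} {m mΩ : MeasurableSpace Ω} {μ : Measure Ω}
    [IsProbabilityMeasure μ] (hm : m ≤ mΩ) {σ u : Ω → ℝ}
    {Z : Ω → ENNReal} (hσ : Measurable σ)
    (hpos : μ {ω | σ ω = 1} = 1 / 2) (hneg : μ {ω | σ ω = -1} = 1 / 2)
    (hind : Indep (MeasurableSpace.comap σ inferInstance) m μ)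
    (hZ : Measurable[m] Z) (hu : Measurable[m] u) :
    ∫⁻ ω, Z ω * ENNReal.ofReal (Real.exp (σ ω * u ω - u ω ^ 2 / 2)) ∂μ ≤ ∫⁻ ω, Z ω ∂μ := by
  set F : ℝ → Ω → ENNReal := fun s ω =>
    Z ω * ENNReal.ofReal (Real.exp (s * u ω - u ω ^ 2 / 2)) with hF
  have hFm : ∀ s, Measurable[m] (F s) := fun s => by
    refine hZ.mul (ENNReal.measurable_ofReal.comp (Real.measurable_exp.comp ?_))
    exact (hu.const_mul s).sub ((hu.pow_const 2).div_const 2)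
  have hm' : ∀ s, MeasurableSet {ω | σ ω = s} := fun s => hσ (measurableSet_singleton s)
  have hI : ∀ s : ℝ, μ {ω | σ ω = s} = 1 / 2 →
      ∫⁻ ω, F s ω * {ω | σ ω = s}.indicator (fun _ => 1) ω ∂μ = ∫⁻ ω, F s ω * (1 / 2) ∂μ := by
    intro s hs
    have hms : MeasurableSet[MeasurableSpace.comap σ inferInstance] {ω | σ ω = s} :=
      ⟨{s}, measurableSet_singleton s, rfl⟩
    rw [lintegral_mul_eq_lintegral_mul_lintegral_of_independent_measurableSpace hm
      hσ.comap_le hind.symm (hFm s) (measurable_const.indicator hms),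
      lintegral_indicator (hm' s), setLIntegral_const, hs, one_mul,
      lintegral_mul_const _ ((hFm s).mono hm le_rfl)]
  have hae : ∀ᵐ ω ∂μ, Z ω * ENNReal.ofReal (Real.exp (σ ω * u ω - u ω ^ 2 / 2))
      = F 1 ω * {ω | σ ω = 1}.indicator (fun _ => 1) ω
        + F (-1) ω * {ω | σ ω = -1}.indicator (fun _ => 1) ω := by
    filter_upwards [ae_eq_one_or_eq_neg_one hσ hpos hneg] with ω hω
    rcases hω with h | h
    · simp [hF, h, Set.indicator, show (1 : ℝ) ≠ -1 by norm_num]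
    · simp [hF, h, Set.indicator, show (-1 : ℝ) ≠ 1 by norm_num]
  have hmi : ∀ s, Measurable fun ω => F s ω * {ω | σ ω = s}.indicator (fun _ => 1) ω := fun s =>
    ((hFm s).mono hm le_rfl).mul
      (measurable_const.indicator (hm' s))
  rw [lintegral_congr_ae hae, lintegral_add_left (hmi 1), hI 1 hpos, hI (-1) hneg,
    ← lintegral_add_left (((hFm 1).mono hm le_rfl).mul_const _)]
  refine lintegral_mono fun ω => ?_
  have h2 : (1 / 2 : ENNReal) = ENNReal.ofReal (1 / 2) := by
    rw [ENNReal.ofReal_div_of_pos two_pos]; simp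
  simp only [hF]
  rw [mul_assoc, mul_assoc, ← mul_add, h2, ← ENNReal.ofReal_mul (Real.exp_pos _).le,
    ← ENNReal.ofReal_mul (Real.exp_pos _).le, ← ENNReal.ofReal_add (by positivity) (by positivity)]
  refine mul_le_of_le_one_right' ?_
  rw [ENNReal.ofReal_le_one]
  have := half_exp_add_half_exp_le_one (u ω)
  rw [one_mul, neg_one_mul]
  linarith

/-- Exponential tail bound for sums `∑ σₖ uₖ` with fair signs `σₖ` independent of the past and
predictable coefficients `uₖ`. -/
lemma measure_le_of_fair_signs (ℱ : Filtration ℕ mΩ) {σ u : ℕ → Ω → ℝ}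
    (hσ : ∀ k, Measurable[ℱ (k + 1)] (σ k))
    (hpos : ∀ k, μ {ω | σ k ω = 1} = 1 / 2) (hneg : ∀ k, μ {ω | σ k ω = -1} = 1 / 2)
    (hind : ∀ k, Indep (MeasurableSpace.comap (σ k) inferInstance) (ℱ k) μ)
    (hu : ∀ k, Measurable[ℱ k] (u k)) (m : ℕ) {δ : ℝ} (hδ : 0 < δ) :
    μ {ω | Real.log (1 / δ) ≤ ∑ k ∈ Finset.range m, (σ k ω * u k ω - u k ω ^ 2 / 2)}
      ≤ ENNReal.ofReal δ := by
  set Z : ℕ → Ω → ENNReal := fun n ω =>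
    ENNReal.ofReal (Real.exp (∑ k ∈ Finset.range n, (σ k ω * u k ω - u k ω ^ 2 / 2))) with hZ
  have hsucc : ∀ n ω, Z (n + 1) ω
      = Z n ω * ENNReal.ofReal (Real.exp (σ n ω * u n ω - u n ω ^ 2 / 2)) := fun n ω => by
    simp only [hZ]
    rw [Finset.sum_range_succ, Real.exp_add, ENNReal.ofReal_mul (Real.exp_pos _).le]
  have hterm : ∀ n, Measurable[ℱ (n + 1)] fun ω => σ n ω * u n ω - u n ω ^ 2 / 2 := fun n => by
    have hu' : Measurable[ℱ (n + 1)] (u n) := (hu n).mono (ℱ.mono n.le_succ) le_rfl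
    exact ((hσ n).mul hu').sub ((hu'.pow_const 2).div_const 2)
  have hZm : ∀ n, Measurable[ℱ n] (Z n) := by
    intro n
    induction n with
    | zero => simp only [hZ, Finset.range_zero, Finset.sum_empty]; exact measurable_const
    | succ n ih =>
      have : Z (n + 1) = fun ω => Z n ω *
          ENNReal.ofReal (Real.exp (σ n ω * u n ω - u n ω ^ 2 / 2)) := funext (hsucc n)
      rw [this]
      exact (ih.mono (ℱ.mono n.le_succ) le_rfl).mul
        (ENNReal.measurable_ofReal.comp (Real.measurable_exp.comp (hterm n)))
  have hint : ∀ n, ∫⁻ ω, Z n ω ∂μ ≤ 1 := by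
    intro n
    induction n with
    | zero => simp [hZ]
    | succ n ih =>
      refine le_trans ?_ ih
      simp_rw [hsucc]
      exact lintegral_mul_exp_sign_le (ℱ.le n) ((hσ n).mono (ℱ.le (n + 1)) le_rfl) (hpos n) (hneg n)
        (hind n) (hZm n) (hu n)
  have hsub : {ω | Real.log (1 / δ) ≤ ∑ k ∈ Finset.range m, (σ k ω * u k ω - u k ω ^ 2 / 2)}
      ⊆ {ω | ENNReal.ofReal (1 / δ) ≤ Z m ω} := by
    intro ω hω
    refine ENNReal.ofReal_le_ofReal ?_
    rwa [← Real.log_le_iff_le_exp (by positivity)]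
  have hpos' : 0 < ENNReal.ofReal (1 / δ) := ENNReal.ofReal_pos.2 (by positivity)
  calc _ ≤ μ {ω | ENNReal.ofReal (1 / δ) ≤ Z m ω} := measure_mono hsub
    _ ≤ (∫⁻ ω, Z m ω ∂μ) / ENNReal.ofReal (1 / δ) :=
        meas_ge_le_lintegral_div ((hZm m).mono (ℱ.le m) le_rfl).aemeasurable hpos'.ne'
          ENNReal.ofReal_ne_top
    _ ≤ 1 / ENNReal.ofReal (1 / δ) := ENNReal.div_le_div_right (hint m) _
    _ = ENNReal.ofReal δ := by
        rw [one_div, one_div, ENNReal.ofReal_inv_of_pos hδ, inv_inv]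

end Signs

/-! ### One iteration of the algorithm -/

/-- The coefficient of the random sign in the first-order change of `f` in iteration `k`. -/
noncomputable def signCoeff {d : ℕ} {Ω : Type*} (f : Vec d → ℝ) (P : Params) (S : Inputs d Ω)
    (x₀ : Vec d) (k : ℕ) : Ω → ℝ :=
  Set.indicator {ω | NCStep P S k ω}
    fun ω => 2 * S.a k ω / P.M * inner ℝ (gradient f (iterate P S x₀ k ω)) (S.p k ω)

/-! ### Predictability of the sign coefficients -/

section Measurability

variable {d : ℕ} {Ω : Type*} [mΩ : MeasurableSpace Ω] {μ : Measure Ω} {ℱ : Filtration ℕ mΩ}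
  {S : Inputs d Ω}

lemma FairSigns.measurable_lamHat (h : FairSigns μ ℱ S) (k : ℕ) :
    Measurable[ℱ k] (lamHat S k) :=
  ((h.p_meas k).inner ((isBoundedBilinearMap_apply.continuous).comp_stronglyMeasurable
    ((h.H_meas k).prodMk (h.p_meas k)))).measurable

lemma FairSigns.measurableSet_gradStep (h : FairSigns μ ℱ S) (P : Params) (k : ℕ) :
    MeasurableSet[ℱ k] {ω | GradStep P S k ω} :=
  measurableSet_lt measurable_const (h.g_meas k).norm.measurable

lemma FairSigns.measurableSet_lamHat_lt (h : FairSigns μ ℱ S) (P : Params) (k : ℕ) :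
    MeasurableSet[ℱ k] {ω | lamHat S k ω < -P.εH} :=
  measurableSet_lt (h.measurable_lamHat k) measurable_const

lemma FairSigns.stronglyMeasurable_iterate (h : FairSigns μ ℱ S) (P : Params) (x₀ : Vec d)
    (k : ℕ) : StronglyMeasurable[ℱ k] (iterate P S x₀ k) := by
  classical
  induction k with
  | zero => exact stronglyMeasurable_const
  | succ k ih =>
    have hle : ℱ k ≤ ℱ (k + 1) := ℱ.mono k.le_succ
    have hx := ih.mono hle
    refine StronglyMeasurable.ite (hle _ (h.measurableSet_gradStep P k))
      (hx.sub (((h.g_meas k).mono hle).const_smul (1 / P.L)))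
      (StronglyMeasurable.ite (hle _ (h.measurableSet_lamHat_lt P k)) (hx.add ?_) hx)
    have hs : StronglyMeasurable[ℱ (k + 1)] fun ω => 2 * S.a k ω / P.M * S.σ k ω := by
      simp_rw [div_eq_mul_inv]
      exact ((((h.a_meas k).mono hle).const_mul 2).mul_const _).mul (h.σ_meas k)
    exact hs.smul ((h.p_meas k).mono hle)

lemma FairSigns.measurable_signCoeff (h : FairSigns μ ℱ S) {f : Vec d → ℝ}
    (hf : Continuous (gradient f)) (P : Params) (x₀ : Vec d) (k : ℕ) :
    Measurable[ℱ k] (signCoeff f P S x₀ k) := by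
  refine Measurable.indicator ?_
    ((h.measurableSet_gradStep P k).compl.inter (h.measurableSet_lamHat_lt P k))
  exact (((h.a_meas k).measurable.const_mul 2).div_const _).mul
    ((hf.comp_stronglyMeasurable (h.stronglyMeasurable_iterate P x₀ k)).inner
      (h.p_meas k)).measurable

end Measurability

/-! ### Decrease and noise in a single step -/

section Step

variable {d : ℕ} {f : Vec d → ℝ} {L M fbar : ℝ}

lemma Smooth.le_sub_of_gradient_step (hf : Smooth f L M fbar) (hL : 0 < L) {ε : ℝ} (hε : 0 < ε)
    {x g : Vec d} (hg : ε < ‖g‖) (hgx : ‖g - gradient f x‖ ≤ 1 / 3 * max ε ‖g‖) :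
    f (x - (1 / L) • g) ≤ f x - ε ^ 2 / (6 * L) := by
  rw [max_eq_right hg.le] at hgx
  have h := hf.le_add_of_gradient_lipschitz x (-((1 / L) • g))
  rw [← sub_eq_add_neg, norm_neg, norm_smul, Real.norm_of_nonneg (by positivity), inner_neg_right,
    real_inner_smul_right] at h
  have hi : 2 / 3 * ‖g‖ ^ 2 ≤ inner ℝ (gradient f x) g := by
    have h1 := real_inner_le_norm (g - gradient f x) g
    rw [inner_sub_left, real_inner_self_eq_norm_sq] at h1
    nlinarith [norm_nonneg g]
  have hsq : ε ^ 2 ≤ ‖g‖ ^ 2 := by gcongr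
  have h2 : 1 / L * (2 / 3 * ‖g‖ ^ 2) ≤ 1 / L * inner ℝ (gradient f x) g := by gcongr
  have h3 : ε ^ 2 / (6 * L) ≤ ‖g‖ ^ 2 / (6 * L) := by gcongr
  have h4 : L / 2 * (1 / L * ‖g‖) ^ 2 = 1 / L * (2 / 3 * ‖g‖ ^ 2) - ‖g‖ ^ 2 / (6 * L) := by
    field_simp
    ring
  linarith

lemma Smooth.le_add_of_negative_curvature_step (hf : Smooth f L M fbar) (hM : 0 < M) {ε a s : ℝ}
    (hε : 0 < ε) (ha : ε ≤ a) (hs : s = 1 ∨ s = -1) {x p : Vec d} {H : Vec d →L[ℝ] Vec d}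
    (hp : ‖p‖ = 1) (hH : ‖H - hessian f x‖ ≤ 2 / 9 * ε) (hlam : inner ℝ p (H p) ≤ -a) :
    f (x + (2 * a / M * s) • p)
      ≤ f x + s * (2 * a / M * inner ℝ (gradient f x) p) - 2 * ε ^ 3 / (9 * M ^ 2) := by
  have ha0 : 0 < a := hε.trans_le ha
  have h := hf.le_add_of_hessian_lipschitz x ((2 * a / M * s) • p)
  have hs2 : s ^ 2 = 1 := by rcases hs with rfl | rfl <;> norm_num
  have hsabs : |s| = 1 := by rcases hs with rfl | rfl <;> norm_num
  have hn : ‖(2 * a / M * s) • p‖ = 2 * a / M := by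
    rw [norm_smul, hp, mul_one, Real.norm_eq_abs, abs_mul, hsabs, mul_one,
      abs_of_pos (by positivity)]
  -- The Hessian error is at most `2/9 ε ≤ 2/9 a`, which leaves `7/9` of the curvature `-a`.
  have hq : inner ℝ (hessian f x p) p ≤ -(7 / 9 * a) := by
    have h1 := real_inner_le_norm p (-((H - hessian f x) p))
    have h2 := (H - hessian f x).le_of_opNorm_le hH p
    rw [norm_neg, hp, one_mul] at h1
    rw [hp, mul_one] at h2
    rw [sub_apply, inner_neg_right, inner_sub_right] at h1
    rw [real_inner_comm]
    rw [sub_apply] at h2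
    linarith
  rw [hn, map_smul, real_inner_smul_left, real_inner_smul_right, real_inner_smul_right] at h
  have h1 : (2 * a / M) ^ 2 / 2 * inner ℝ (hessian f x p) p
      ≤ (2 * a / M) ^ 2 / 2 * -(7 / 9 * a) := by gcongr
  have h2 : 1 / 2 * (2 * a / M * s * (2 * a / M * s * inner ℝ (hessian f x p) p))
      = s ^ 2 * ((2 * a / M) ^ 2 / 2 * inner ℝ (hessian f x p) p) := by ring
  rw [h2, hs2, one_mul] at h
  have h3 : 2 * ε ^ 3 / (9 * M ^ 2) ≤ 2 * a ^ 3 / (9 * M ^ 2) := by gcongr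
  -- In units of `a³/M²`: `-14/9` from curvature plus `12/9` from the cubic remainder.
  have h4 : (2 * a / M) ^ 2 / 2 * -(7 / 9 * a) + M / 6 * (2 * a / M) ^ 3
      = -(2 * a ^ 3 / (9 * M ^ 2)) := by
    field_simp
    ring
  linarith

lemma abs_signCoeff_le_of_inexact {M ε a α : ℝ} (hM : 0 < M) (ha : 0 ≤ a)
    (haα : a ≤ α) {x g p : Vec d} (hp : ‖p‖ = 1) (hg : ‖g‖ ≤ ε)
    (hgx : ‖g - gradient f x‖ ≤ 1 / 3 * max ε ‖g‖) :
    |2 * a / M * inner ℝ (gradient f x) p| ≤ 8 * α * ε / (3 * M) := by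
  rw [max_eq_left hg] at hgx
  have h1 := abs_real_inner_le_norm (gradient f x) p
  rw [hp, mul_one] at h1
  have h2 : ‖gradient f x‖ ≤ 4 / 3 * ε := by
    have := norm_sub_norm_le (gradient f x) g
    rw [norm_sub_rev] at this
    linarith
  have hε : 0 ≤ ε := (norm_nonneg g).trans hg
  rw [abs_mul, abs_of_nonneg (by positivity)]
  calc 2 * a / M * |inner ℝ (gradient f x) p| ≤ 2 * α / M * (4 / 3 * ε) := by
        have h3 := h1.trans h2
        have hα : 0 ≤ α := ha.trans haα
        gcongr
    _ = 8 * α * ε / (3 * M) := by field_simp; ring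

end Step

/-! ### Accumulated decrease along an execution -/

section Execution

variable {d : ℕ} {Ω : Type*}

/-- The number of negative curvature steps among the first `k` iterations. -/
noncomputable def ncCount (P : Params) (S : Inputs d Ω) (k : ℕ) (ω : Ω) : ℝ :=
  ∑ j ∈ Finset.range k, Set.indicator {ω | NCStep P S j ω} 1 ω

/-- The requirements of `InexactDerivatives`, `ApproxEigenvector` and `StepSizeRule` on
iteration `k` that control the change of `f`, together with `σₖ = ±1`. -/
structure GoodIteration (f : Vec d → ℝ) (P : Params) (S : Inputs d Ω) (x₀ : Vec d) (k : ℕ)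
    (ω : Ω) : Prop where
  sign : S.σ k ω = 1 ∨ S.σ k ω = -1
  notReturning : ¬ StopTest P S k ω
  gradient_error : ‖S.g k ω - gradient f (iterate P S x₀ k ω)‖ ≤ 1 / 3 * max P.εg ‖S.g k ω‖
  hessian_error : ¬ GradStep P S k ω →
    ‖S.H k ω - hessian f (iterate P S x₀ k ω)‖ ≤ 2 / 9 * P.εH
  norm_direction : ¬ GradStep P S k ω → ‖S.p k ω‖ = 1
  stepSize : NCStep P S k ω → S.a k ω ∈ Set.Icc P.εH (min P.α |lamHat S k ω|)

variable {f : Vec d → ℝ} {P : Params} {S : Inputs d Ω} {x₀ : Vec d} {fbar : ℝ} {k : ℕ} {ω : Ω}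

lemma GoodIteration.le (hf : Smooth f P.L P.M fbar) (h : GoodIteration f P S x₀ k ω) :
    f (iterate P S x₀ (k + 1) ω) ≤ f (iterate P S x₀ k ω) + S.σ k ω * signCoeff f P S x₀ k ω
      - (P.εg ^ 2 / (6 * P.L) * (1 - Set.indicator {ω | NCStep P S k ω} 1 ω)
        + 2 * P.εH ^ 3 / (9 * P.M ^ 2) * Set.indicator {ω | NCStep P S k ω} 1 ω) := by
  by_cases hg : GradStep P S k ω
  · have hnc : ω ∉ {ω | NCStep P S k ω} := fun h' => h'.1 hg
    have := hf.le_sub_of_gradient_step P.L_pos P.εg_pos hg h.gradient_error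
    simp only [iterate, if_pos hg, signCoeff, Set.indicator_of_notMem hnc]
    linarith
  · have hlam : lamHat S k ω < -P.εH := by
      by_contra hlam
      exact h.notReturning ⟨hg, hlam⟩
    have hnc : ω ∈ {ω | NCStep P S k ω} := ⟨hg, hlam⟩
    obtain ⟨ha, ha'⟩ := h.stepSize hnc
    have hlam' : lamHat S k ω ≤ -S.a k ω := by
      have := ha'.trans (min_le_right _ _)
      rw [abs_of_neg (hlam.trans (neg_neg_of_pos P.εH_pos))] at this
      linarith
    have := hf.le_add_of_negative_curvature_step P.M_pos P.εH_pos ha h.sign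
      (h.norm_direction hg) (h.hessian_error hg) hlam'
    simp only [iterate, if_neg hg, if_pos hlam, signCoeff, Set.indicator_of_mem hnc, Pi.one_apply]
    linarith

lemma GoodIteration.abs_signCoeff_le (h : GoodIteration f P S x₀ k ω) :
    |signCoeff f P S x₀ k ω|
      ≤ 8 * P.α * P.εg / (3 * P.M) * Set.indicator {ω | NCStep P S k ω} 1 ω := by
  by_cases hnc : ω ∈ {ω | NCStep P S k ω}
  · obtain ⟨ha, ha'⟩ := h.stepSize hnc
    simp only [signCoeff, Set.indicator_of_mem hnc, Pi.one_apply, mul_one]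
    exact abs_signCoeff_le_of_inexact P.M_pos (P.εH_pos.le.trans ha)
      (ha'.trans (min_le_left _ _)) (h.norm_direction hnc.1) (not_lt.1 hnc.1) h.gradient_error
  · simp [signCoeff, Set.indicator_of_notMem hnc]

lemma add_decrease_le_of_forall_good (hf : Smooth f P.L P.M fbar) {m : ℕ}
    (h : ∀ k < m, GoodIteration f P S x₀ k ω) :
    f (iterate P S x₀ m ω) + (P.εg ^ 2 / (6 * P.L) * (m - ncCount P S m ω)
        + 2 * P.εH ^ 3 / (9 * P.M ^ 2) * ncCount P S m ω)
      ≤ f x₀ + ∑ k ∈ Finset.range m, S.σ k ω * signCoeff f P S x₀ k ω := by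
  induction m with
  | zero => simp [ncCount, iterate]
  | succ m ih =>
    have h1 := ih fun k hk => h k (hk.trans m.lt_succ_self)
    have h2 := (h m m.lt_succ_self).le hf
    simp only [ncCount, Finset.sum_range_succ, Nat.cast_succ] at h1 ⊢
    linarith

/-- A worst-case bound that ignores cancellation between signs; it serves only to force many
negative curvature steps. -/
lemma sum_sign_mul_le_of_forall_good {m : ℕ} (h : ∀ k < m, GoodIteration f P S x₀ k ω) :
    ∑ k ∈ Finset.range m, S.σ k ω * signCoeff f P S x₀ k ω
      ≤ 8 * P.α * P.εg / (3 * P.M) * ncCount P S m ω := by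
  rw [ncCount, Finset.mul_sum]
  refine Finset.sum_le_sum fun k hk => ?_
  have hk := h k (Finset.mem_range.1 hk)
  refine le_trans ?_ hk.abs_signCoeff_le
  rcases hk.sign with hs | hs <;> rw [hs]
  · rw [one_mul]; exact le_abs_self _
  · rw [neg_one_mul]; exact neg_le_abs _

lemma sum_sq_le_of_forall_good {m : ℕ} (h : ∀ k < m, GoodIteration f P S x₀ k ω) :
    ∑ k ∈ Finset.range m, signCoeff f P S x₀ k ω ^ 2
      ≤ (8 * P.α * P.εg / (3 * P.M)) ^ 2 * ncCount P S m ω := by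
  rw [ncCount, Finset.mul_sum]
  refine Finset.sum_le_sum fun k hk => ?_
  have hk := (h k (Finset.mem_range.1 hk)).abs_signCoeff_le
  rw [← sq_abs]
  by_cases hnc : ω ∈ {ω | NCStep P S k ω}
  · rw [Set.indicator_of_mem hnc, Pi.one_apply, mul_one] at hk ⊢
    gcongr
  · rw [Set.indicator_of_notMem hnc, mul_zero] at hk ⊢
    rw [abs_nonpos_iff.1 hk]
    simp

lemma Params.α_pos (P : Params) : 0 < P.α := P.εH_pos.trans_le P.εH_le_α

lemma Ceps_pos (P : Params) : 0 < Ceps P := by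
  have := P.L_pos
  have := P.M_pos
  have := P.εg_pos
  have := P.εH_pos
  exact lt_min (by positivity) (by positivity)

/-- If `N` of at least `iterBound` steps are negative curvature steps, and the accumulated
decrease of `f` is at most `Δ + T`, then the accumulated sign noise `T`, with quadratic
variation `V`, is improbably large. -/
lemma log_le_of_iterBound_le (P : Params) {Δ δ m N T V : ℝ} (η : ℕ) (hδ : 0 < δ) (hδ1 : δ < 1)
    (hΔ : 0 ≤ Δ) (hm : iterBound P Δ δ η ≤ m)
    (hdec : P.εg ^ 2 / (6 * P.L) * (m - N) + 2 * P.εH ^ 3 / (9 * P.M ^ 2) * N ≤ Δ + T)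
    (hNm : N ≤ m) (hN : 0 ≤ N)
    (hT : T ≤ 8 * P.α * P.εg / (3 * P.M) * N)
    (hV : V ≤ (8 * P.α * P.εg / (3 * P.M)) ^ 2 * N) :
    Real.log (1 / δ) ≤
      2 * P.εH ^ 3 / (9 * P.M ^ 2) / (2 * (8 * P.α * P.εg / (3 * P.M)) ^ 2) * T
      - (2 * P.εH ^ 3 / (9 * P.M ^ 2) / (2 * (8 * P.α * P.εg / (3 * P.M)) ^ 2)) ^ 2 / 2 * V := by
  have hL := P.L_pos
  have hM := P.M_pos
  have hg := P.εg_pos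
  have hH := P.εH_pos
  have hα := P.α_pos
  have hCe := Ceps_pos P
  have hlog : 0 < Real.log (1 / δ) := Real.log_pos (by rw [lt_div_iff₀ hδ]; linarith)
  have hK : constC P * Real.log (1 / δ) ≤ constK P Δ δ η := le_max_left _ _
  have hCg : Ceps P ≤ P.εg ^ 2 / (6 * P.L) := min_le_left _ _
  have hCH : Ceps P ≤ 2 * P.εH ^ 3 / (9 * P.M ^ 2) := min_le_right _ _
  -- The constant 2304 in `C` is what makes `C = 16 c² / c₁²`.
  have hC : constC P * (2 * P.εH ^ 3 / (9 * P.M ^ 2)) ^ 2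
      = 16 * (8 * P.α * P.εg / (3 * P.M)) ^ 2 := by
    rw [constC]; field_simp; ring
  -- `B` is chosen so that `cg * B` dominates `cg + c`, the cost of trading a gradient step for a
  -- worst-case negative curvature step.
  have hB : P.εg ^ 2 / (6 * P.L) + 8 * P.α * P.εg / (3 * P.M)
      ≤ P.εg ^ 2 / (6 * P.L) * constB P := by
    have : P.εg ^ 2 / (6 * P.L) * constB P
        = P.εg ^ 2 / (6 * P.L) + 9 / 8 * (8 * P.α * P.εg / (3 * P.M)) := by
      rw [constB]; field_simp; ring
    rw [this]
    have : 0 < 8 * P.α * P.εg / (3 * P.M) := by positivity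
    linarith
  have hBpos : 0 < constB P := by rw [constB]; positivity
  have hCpos : 0 < constC P := by rw [constC]; positivity
  have hΔC : Ceps P * (Δ / Ceps P) = Δ := by field_simp
  rw [iterBound] at hm
  set cg := P.εg ^ 2 / (6 * P.L) with hcg
  set c₁ := 2 * P.εH ^ 3 / (9 * P.M ^ 2) with hc₁
  set c := 8 * P.α * P.εg / (3 * P.M) with hc
  have hcgpos : 0 < cg := by positivity
  have hc₁pos : 0 < c₁ := by positivity
  have hcpos : 0 < c := by positivity
  set q := Δ / Ceps P with hq
  have hq0 : 0 ≤ q := by positivity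
  set K := constK P Δ δ η with hKdef
  have hKpos : 0 < K := (mul_pos hCpos hlog).trans_le hK
  -- If `N < K`, then `cg m ≤ Δ + (cg + c) N < Δ + cg B K`, whereas `m ≥ 2q + B K` and `Δ ≤ cg q`.
  have hNK : K ≤ N := by
    by_contra! hlt
    have h1 : cg * (2 * q + constB P * K) ≤ cg * m := by gcongr
    have h2 : (cg + c) * N ≤ cg * constB P * N := by gcongr
    have h3 : cg * constB P * N < cg * constB P * K := by gcongr
    have h4 : Ceps P * q ≤ cg * q := by gcongr
    have h5 : 0 ≤ c₁ * N := by positivity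
    have h6 : 0 ≤ cg * q := by positivity
    linarith
  -- From `m ≥ 2q`, `Δ` is at most half of `Cε m`, hence at most half of the guaranteed decrease.
  have hT' : c₁ / 2 * N ≤ T := by
    have h1 : Ceps P * (m - N) ≤ cg * (m - N) := by
      have : 0 ≤ m - N := sub_nonneg.2 hNm
      gcongr
    have h2 : Ceps P * N ≤ c₁ * N := by gcongr
    have h3 : Ceps P * (2 * q) ≤ Ceps P * m := by
      have : 0 ≤ constB P * K := by positivity
      gcongr
      linarith
    have h4 : 0 ≤ cg * (m - N) := mul_nonneg hcgpos.le (sub_nonneg.2 hNm)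
    linarith
  -- Of `K` only `K ≥ C log (1/δ)` enters here; the constants give `2 log (1/δ)`, a factor 2 more
  -- than needed.
  calc Real.log (1 / δ) ≤ 2 * Real.log (1 / δ) := by linarith
    _ = c₁ ^ 2 / (8 * c ^ 2) * (constC P * Real.log (1 / δ)) := by
        have : constC P = 16 * c ^ 2 / c₁ ^ 2 := by rw [← hC]; field_simp
        rw [this]; field_simp; ring
    _ ≤ c₁ ^ 2 / (8 * c ^ 2) * N := by
        gcongr
        exact hK.trans hNK
    _ = c₁ / (2 * c ^ 2) * (c₁ / 2 * N) - (c₁ / (2 * c ^ 2)) ^ 2 / 2 * (c ^ 2 * N) := by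
        field_simp; ring
    _ ≤ c₁ / (2 * c ^ 2) * T - (c₁ / (2 * c ^ 2)) ^ 2 / 2 * V := by gcongr

lemma ncCount_nonneg (m : ℕ) : 0 ≤ ncCount P S m ω :=
  Finset.sum_nonneg fun _ _ => Set.indicator_nonneg (fun _ _ => zero_le_one) _

lemma ncCount_le (m : ℕ) : ncCount P S m ω ≤ m := by
  calc ncCount P S m ω ≤ ∑ _j ∈ Finset.range m, (1 : ℝ) :=
        Finset.sum_le_sum fun _ _ => Set.indicator_le_self' (fun _ _ => zero_le_one) _
    _ = m := by simp

/-- The first iteration whose stop test succeeds is a return, so without a return no stop test has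
succeeded. -/
lemma reached_of_forall_not_returnsAt {m : ℕ} (h : ∀ k < m, ¬ ReturnsAt P S k ω) :
    Reached P S m ω := by
  intro j
  induction j using Nat.strong_induction_on with
  | _ j ih => exact fun hj hret => h j hj ⟨fun i hi => ih i hi (hi.trans hj), hret⟩

end Execution

end RandNC

/-- Iterations are numbered `0, 1, 2, …`; returning in an iteration `k < n` means that at most
`⌈n⌉` iterations are executed, the one that returns included. -/
theorem mainTheorem1 {d : ℕ} (f : RandNC.Vec d → ℝ) (fbar : ℝ) (P : RandNC.Params)
    (hf : RandNC.Smooth f P.L P.M fbar) (x₀ : RandNC.Vec d)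
    {Ω : Type*} [mΩ : MeasurableSpace Ω] (μ : Measure Ω) [IsProbabilityMeasure μ]
    (ℱ : Filtration ℕ mΩ) (S : RandNC.Inputs d Ω)
    (hsigns : RandNC.FairSigns μ ℱ S)
    (hinexact : RandNC.InexactDerivatives μ f P S x₀)
    (heig : RandNC.ApproxEigenvector μ P S)
    (hstep : RandNC.StepSizeRule μ P S)
    (δ : ℝ) (hδ : 0 < δ) (hδ1 : δ < 1) (η : ℕ) (hη : 2 ≤ η) :
    1 - δ ≤ μ.real {ω | ∃ k : ℕ, (k : ℝ) < RandNC.iterBound P (f x₀ - fbar) δ η ∧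
      RandNC.ReturnsAt P S k ω} := by
  set n := RandNC.iterBound P (f x₀ - fbar) δ η with hn
  set m := ⌈n⌉₊ with hm
  set G : Set Ω := {ω | ∃ k : ℕ, (k : ℝ) < n ∧ RandNC.ReturnsAt P S k ω} with hG
  -- `l = c₁/(2c²)` maximizes `l c₁/2 - l² c²/2`, the guaranteed exponent per negative curvature
  -- step.
  set l : ℝ := 2 * P.εH ^ 3 / (9 * P.M ^ 2) / (2 * (8 * P.α * P.εg / (3 * P.M)) ^ 2) with hl
  set u : ℕ → Ω → ℝ := fun k ω => l * RandNC.signCoeff f P S x₀ k ω with hu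
  set E : Set Ω := {ω | Real.log (1 / δ) ≤
    ∑ k ∈ Finset.range m, (S.σ k ω * u k ω - u k ω ^ 2 / 2)} with hE
  have hσ : ∀ k, Measurable[ℱ (k + 1)] (S.σ k) := fun k => (hsigns.σ_meas k).measurable
  have hcont : Continuous (gradient f) := hf.differentiable_gradient.continuous
  have hEle : μ E ≤ ENNReal.ofReal δ :=
    RandNC.measure_le_of_fair_signs ℱ hσ hsigns.σ_pos hsigns.σ_neg hsigns.σ_indep
      (fun k => (hsigns.measurable_signCoeff hcont P x₀ k).const_mul l) m hδ
  -- The signed sums are taken up to the fixed time `m` on all of `Ω`, so no stopping time is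
  -- needed; the bounds on them are used only where the algorithm is still running.
  have hsub : ∀ᵐ ω ∂μ, ω ∈ Gᶜ → ω ∈ E := by
    have hsign : ∀ᵐ ω ∂μ, ∀ k, S.σ k ω = 1 ∨ S.σ k ω = -1 := ae_all_iff.2 fun k =>
      RandNC.ae_eq_one_or_eq_neg_one ((hσ k).mono (ℱ.le _) le_rfl) (hsigns.σ_pos k)
        (hsigns.σ_neg k)
    filter_upwards [hinexact, heig, hstep, hsign] with ω h1 h2 h3 h4 hω
    have hreach : RandNC.Reached P S m ω := RandNC.reached_of_forall_not_returnsAt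
      fun k hk hret => hω ⟨k, Nat.lt_ceil.1 hk, hret⟩
    have hgood : ∀ k < m, RandNC.GoodIteration f P S x₀ k ω := fun k hk => by
      have hr : RandNC.Reached P S k ω := fun j hj => hreach j (hj.trans hk)
      exact ⟨h4 k, hreach k hk, (h1 k hr).1, fun hg => ((h1 k hr).2 hg).2,
        fun hg => (h2 k hr hg).1, h3 k hr⟩
    have hdec := RandNC.add_decrease_le_of_forall_good hf hgood
    have hlow := hf.lower_bound (RandNC.iterate P S x₀ m ω)
    have hfin := RandNC.log_le_of_iterBound_le P η hδ hδ1
      (sub_nonneg.2 (hf.lower_bound x₀)) (Nat.le_ceil n) (N := RandNC.ncCount P S m ω)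
      (T := ∑ k ∈ Finset.range m, S.σ k ω * RandNC.signCoeff f P S x₀ k ω)
      (by linarith) (RandNC.ncCount_le m) (RandNC.ncCount_nonneg m)
      (RandNC.sum_sign_mul_le_of_forall_good hgood) (RandNC.sum_sq_le_of_forall_good hgood)
    refine hfin.trans_eq ?_
    rw [Finset.mul_sum, Finset.mul_sum, ← Finset.sum_sub_distrib]
    refine Finset.sum_congr rfl fun k _ => ?_
    simp only [hu]
    ring
  have hGc : μ.real Gᶜ ≤ δ :=
    ENNReal.toReal_le_of_le_ofReal hδ.le ((measure_mono_ae hsub).trans hEle)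
  have huniv : 1 ≤ μ.real G + μ.real Gᶜ := by
    have := measureReal_union_le (μ := μ) G Gᶜ
    rwa [Set.union_compl_self, probReal_univ] at this
  linarith
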